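/- \textbf{Theorem (Completeness of $APAL_{int}$).} Let $\mathit{Prop}$ be a countable set of propositional variables and $\mathcal{A}$ a finite non-empty set of agents. Let $\mathcal{L}$ be the language $$\varphi ::= p \mid \neg\varphi \mid \varphi\wedge\varphi \mid K_i\varphi \mid int(\varphi) \mid [\varphi]\varphi \mid \Box\varphi \qquad (p\in \mathit{Prop},\ i\in\mathcal{A}),$$ with $\varphi\to\psi := \neg(\varphi\wedge\neg\psi)$ and $\varphi\leftrightarrow\psi := (\varphi\to\psi)\wedge(\psi\to\varphi)$, and let $\mathcal{L}_{PAL}$ be the set of formulas without $\Box$. If $\varphi\in\mathcal{L}$ is valid on all topo-models, then $\varphi$ is a theorem of $APAL_{int}$. The notions are as follows. \emph{Topo-models.} A topo-model is $\mathcal{M}=(X,\tau,\Phi,V)$, where $(X,\tau)$ is a non-empty topological space, $V:\mathit{Prop}\to\mathcal{P}(X)$, and $\Phi$ is a set of partial functions $\theta$ from $X$ to the set of functions $\mathcal{A}\to\tau$ such that for all $\theta\in\Phi$, $x,y\in Dom(\theta)$, $i\in\mathcal{A}$ and $U\in\tau$: (1) $x\in\theta(x)(i)$; (2) $\theta(x)(i)\subseteq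 Dom(\theta)$; (3) if $y\in\theta(x)(i)$ then $\theta(x)(i)=\theta(y)(i)$; (4) $\theta|_U\in\Phi$, where $Dom(\theta|_U)=Dom(\theta)\cap U$ and $\theta|_U(x)(i)=\theta(x)(i)\cap U$. \emph{Semantics.} For $\theta\in\Phi$ and $x\in Dom(\theta)$, write $[\![\varphi]\!]^\theta=\{y\in Dom(\theta) : (y,\theta)\models\varphi\}$, let $Int$ be the interior in $(X,\tau)$, and let $\theta^\varphi=\theta|_{Int[\![\varphi]\!]^\theta}$. Then \begin{itemize} \item $(x,\theta)\models p$ iff $x\in V(p)$; $\neg$ and $\wedge$ are Boolean; \item $(x,\theta)\models K_i\varphi$ iff $(y,\theta)\models\varphi$ for all $y\in\theta(x)(i)$; \item $(x,\theta)\models int(\varphi)$ iff $x\in Int[\![\varphi]\!]^\theta$; \item $(x,\theta)\models[\varphi]\psi$ iff $(x,\theta)\models int(\varphi)$ implies $(x,\theta^\varphi)\models\psi$; \item $(x,\theta)\models\Box\varphi$ iff $(x,\theta)\models[\psi]\varphi$ for all $\psi\in\mathcal{L}_{PAL}$. \end{itemize} A formula is valid on all topo-models if it is true at every $(x,\theta)$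 with $\theta\in\Phi$ and $x\in Dom(\theta)$ in every topo-model. \emph{Axiomatization.} Necessity forms are $\xi(\sharp)::=\sharp\mid\varphi\to\xi(\sharp)\mid K_i\xi(\sharp)\mid int(\xi(\sharp))\mid[\varphi]\xi(\sharp)$ with $\varphi\in\mathcal{L}$ and $i\in\mathcal{A}$; $\xi(\varphi)$ is the result of replacing $\sharp$ by $\varphi$. The theorems of $APAL_{int}$ form the smallest set of formulas that contains, for all $\varphi,\psi,\chi\in\mathcal{L}$, $i\in\mathcal{A}$ and $p\in\mathit{Prop}$ (with $\chi\in\mathcal{L}_{PAL}$ in (R7)), \begin{itemize} \item (P) all instances of propositional tautologies; \item ($K$-K) $K_i(\varphi\to\psi)\to(K_i\varphi\to K_i\psi)$; ($K$-T) $K_i\varphi\to\varphi$; ($K$-4) $K_i\varphi\to K_iK_i\varphi$; ($K$-5) $\neg K_i\varphi\to K_i\neg K_i\varphi$; \item ($int$-K) $int(\varphi\to\psi)\to(int(\varphi)\to int(\psi))$; ($int$-T) $int(\varphi)\to\varphi$; ($int$-4) $int(\varphi)\to int(int(\varphi))$; ($K_{int}$) $K_i\varphi\to int(\varphi)$; \item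 (R1) $[\varphi]p\leftrightarrow(int(\varphi)\to p)$; (R2) $[\varphi]\neg\psi\leftrightarrow(int(\varphi)\to\neg[\varphi]\psi)$; (R3) $[\varphi](\psi\wedge\chi)\leftrightarrow[\varphi]\psi\wedge[\varphi]\chi$; (R4) $[\varphi]int(\psi)\leftrightarrow(int(\varphi)\to int([\varphi]\psi))$; (R5) $[\varphi]K_i\psi\leftrightarrow(int(\varphi)\to K_i[\varphi]\psi)$; (R6) $[\varphi][\psi]\chi\leftrightarrow[\neg[\varphi]\neg int(\psi)]\chi$; (R7) $\Box\varphi\to[\chi]\varphi$ \end{itemize} and is closed under: (DR1) from $\varphi$ and $\varphi\to\psi$ infer $\psi$; (DR2) from $\varphi$ infer $K_i\varphi$; (DR3) from $\varphi$ infer $int(\varphi)$; (DR4) from $\varphi$ infer $[\psi]\varphi$; (DR5) from $\xi([\psi]\chi)$ for all $\psi\in\mathcal{L}_{PAL}$ infer $\xi(\Box\chi)$. -/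

import Mathlib

universe u v w

namespace APAL

open TopologicalSpace

/-! ### Language -/

/-- The full language over propositional variables `P` and agents `A`:
`p | ¬φ | φ ∧ φ | K_i φ | int(φ) | [φ]φ | □φ`. -/
inductive Formula (P : Type u) (A : Type v) : Type (max u v) where
  | var (p : P) : Formula P A
  | neg (φ : Formula P A) : Formula P A
  | and (φ ψ : Formula P A) : Formula P A
  | know (i : A) (φ : Formula P A) : Formula P A
  | intr (φ : Formula P A) : Formula P A
  | ann (φ ψ : Formula P A) : Formula P A
  | box (φ : Formula P A) : Formula P A

namespace Formula

variable {P : Type u} {A : Type v}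

/-- `φ → ψ` abbreviates `¬(φ ∧ ¬ψ)`. -/
def imp (φ ψ : Formula P A) : Formula P A := neg (and φ (neg ψ))

/-- `φ ↔ ψ` abbreviates `(φ → ψ) ∧ (ψ → φ)`. -/
def iff (φ ψ : Formula P A) : Formula P A := and (imp φ ψ) (imp ψ φ)

/-- The fragment without `□` (announcements allowed). -/
def BoxFree : Formula P A → Prop
  | var _ => True
  | neg φ => BoxFree φ
  | and φ ψ => BoxFree φ ∧ BoxFree ψ
  | know _ φ => BoxFree φ
  | intr φ => BoxFree φ
  | ann φ ψ => BoxFree φ ∧ BoxFree ψ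
  | box _ => False

/-- The size of a formula. -/
def size : Formula P A → ℕ
  | var _ => 1
  | neg φ => size φ + 1
  | and φ ψ => size φ + size ψ
  | know _ φ => size φ + 1
  | intr φ => size φ + 1
  | ann φ ψ => size φ + 4 * size ψ
  | box φ => size φ + 1

/-- The `□`-depth of a formula. -/
def depth : Formula P A → ℕ
  | var _ => 0
  | neg φ => depth φ
  | and φ ψ => max (depth φ) (depth ψ)
  | know _ φ => depth φ
  | intr φ => depth φ
  | ann φ ψ => max (depth φ) (depth ψ)
  | box φ => depth φ + 1

theorem size_pos (φ : Formula P A) : 0 < size φ := by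
  induction φ <;> simp only [size] <;> omega

theorem BoxFree.depth_eq_zero {φ : Formula P A} (h : BoxFree φ) : depth φ = 0 := by
  induction φ <;> simp_all [BoxFree, depth]

end Formula

/-- Necessity forms `ξ(♯) ::= ♯ | φ → ξ(♯) | K_i ξ(♯) | int(ξ(♯)) | [φ]ξ(♯)`. -/
inductive NecForm (P : Type u) (A : Type v) : Type (max u v) where
  | hole : NecForm P A
  | imp (φ : Formula P A) (ξ : NecForm P A) : NecForm P A
  | know (i : A) (ξ : NecForm P A) : NecForm P A
  | intr (ξ : NecForm P A) : NecForm P A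
  | ann (φ : Formula P A) (ξ : NecForm P A) : NecForm P A

/-- `ξ(φ)`: replace the hole of `ξ` by `φ`. -/
def NecForm.fill {P : Type u} {A : Type v} (χ : Formula P A) : NecForm P A → Formula P A
  | hole => χ
  | imp φ ξ => Formula.imp φ (ξ.fill χ)
  | know i ξ => Formula.know i (ξ.fill χ)
  | intr ξ => Formula.intr (ξ.fill χ)
  | ann φ ξ => Formula.ann φ (ξ.fill χ)

/-! ### Structures -/

section Structures

variable {X : Type w} [TopologicalSpace X] {A : Type v}

/-- The restriction `θ|_U`: `Dom(θ|_U) = Dom(θ) ∩ U` and `θ|_U(x)(i) = θ(x)(i) ∩ U`. -/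
def restrict (θ : X →. (A → Opens X)) (U : Opens X) : X →. (A → Opens X) :=
  fun x => ⟨x ∈ θ.Dom ∧ x ∈ U, fun h i => θ.fn x h.1 i ⊓ U⟩

/-- `Φ` is a neighbourhood function set. The values `θ(x)(i)` are open by typing. -/
structure IsNbhdFunSet (Φ : Set (X →. (A → Opens X))) : Prop where
  mem_self : ∀ θ ∈ Φ, ∀ (x : X) (hx : x ∈ θ.Dom) (i : A), x ∈ θ.fn x hx i
  subset_dom : ∀ θ ∈ Φ, ∀ (x : X) (hx : x ∈ θ.Dom) (i : A), (θ.fn x hx i : Set X) ⊆ θ.Dom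
  eq_of_mem : ∀ θ ∈ Φ, ∀ (x y : X) (hx : x ∈ θ.Dom) (hy : y ∈ θ.Dom) (i : A),
    y ∈ θ.fn x hx i → θ.fn x hx i = θ.fn y hy i
  restrict_mem : ∀ θ ∈ Φ, ∀ U : Opens X, restrict θ U ∈ Φ

end Structures

/-- Topo-models `(X, τ, Φ, V)`. -/
structure TopoModel (P : Type u) (A : Type v) where
  X : Type w
  [nonempty : Nonempty X]
  [top : TopologicalSpace X]
  Φ : Set (X →. (A → Opens X))
  isNbhdFunSet : IsNbhdFunSet Φ
  V : P → Set X

/-! ### Semantics -/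

/-- Truth at `(x, θ)`. It is only meaningful (and only used) at neighbourhood situations,
that is, for `x ∈ Dom(θ)`. The recursion is on `□`-depth, then size. -/
def Sat {P : Type u} {A : Type v} {X : Type w} [TopologicalSpace X] (V : P → Set X)
    (θ : X →. (A → Opens X)) (x : X) : Formula P A → Prop
  | .var p => x ∈ V p
  | .neg φ => ¬ Sat V θ x φ
  | .and φ ψ => Sat V θ x φ ∧ Sat V θ x ψ
  | .know i φ => ∀ hx : x ∈ θ.Dom, ∀ y ∈ θ.fn x hx i, Sat V θ y φ
  | .intr φ => x ∈ interior {y | y ∈ θ.Dom ∧ Sat V θ y φ}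
  | .ann φ ψ => Sat V θ x (.intr φ) →
      Sat V (restrict θ ⟨interior {y | y ∈ θ.Dom ∧ Sat V θ y φ}, isOpen_interior⟩) x ψ
  | .box φ => ∀ ψ : Formula P A, ψ.BoxFree → Sat V θ x (.ann ψ φ)
termination_by φ => (φ.depth, φ.size)
decreasing_by
  all_goals
    simp only [Prod.lex_def, Formula.depth, Formula.size, true_and]
  · omega
  · have := Formula.size_pos ψ; omega
  · have := Formula.size_pos φ; omega
  · omega
  · omega
  · have := Formula.size_pos ψ; omega
  · have := Formula.size_pos ψ; omega
  · have := Formula.size_pos φ; have := Formula.size_pos ψ; omega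
  · rename_i hψ
    have := hψ.depth_eq_zero
    omega

/-- `φ` is valid in the topo-model `M`: true at all neighbourhood situations of `M`. -/
def TopoModel.Valid {P : Type u} {A : Type v} (M : TopoModel.{u, v, w} P A)
    (φ : Formula P A) : Prop :=
  letI := M.top
  ∀ θ ∈ M.Φ, ∀ x ∈ θ.Dom, Sat M.V θ x φ

/-- `φ` is valid: valid in all topo-models (with carrier in `Type w`). -/
def Valid {P : Type u} {A : Type v} (φ : Formula P A) : Prop :=
  ∀ M : TopoModel.{u, v, w} P A, M.Valid φ

/-! ### Axiomatization -/

/-- Propositional formulas over countably many letters. -/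
inductive PropFormula : Type where
  | letter (n : ℕ) : PropFormula
  | neg (t : PropFormula) : PropFormula
  | and (s t : PropFormula) : PropFormula

/-- Truth of a propositional formula under a truth assignment. -/
def PropFormula.eval (e : ℕ → Prop) : PropFormula → Prop
  | letter n => e n
  | neg t => ¬ t.eval e
  | and s t => s.eval e ∧ t.eval e

/-- Substitution of formulas for the letters of a propositional formula. -/
def PropFormula.inst {P : Type u} {A : Type v} (σ : ℕ → Formula P A) :
    PropFormula → Formula P A
  | letter n => σ n
  | neg t => .neg (t.inst σ)
  | and s t => .and (s.inst σ) (t.inst σ)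

open Formula in
/-- Theorems of the axiomatization: the smallest set of formulas containing the axioms and closed
under the derivation rules. -/
inductive Provable {P : Type u} {A : Type v} : Formula P A → Prop where
  | taut (t : PropFormula) (ht : ∀ e : ℕ → Prop, t.eval e) (σ : ℕ → Formula P A) :
      Provable (t.inst σ)
  | know_K (i : A) (φ ψ : Formula P A) :
      Provable (imp (know i (imp φ ψ)) (imp (know i φ) (know i ψ)))
  | know_T (i : A) (φ : Formula P A) : Provable (imp (know i φ) φ)
  | know_4 (i : A) (φ : Formula P A) : Provable (imp (know i φ) (know i (know i φ)))
  | know_5 (i : A) (φ : Formula P A) :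
      Provable (imp (neg (know i φ)) (know i (neg (know i φ))))
  | intr_K (φ ψ : Formula P A) :
      Provable (imp (intr (imp φ ψ)) (imp (intr φ) (intr ψ)))
  | intr_T (φ : Formula P A) : Provable (imp (intr φ) φ)
  | intr_4 (φ : Formula P A) : Provable (imp (intr φ) (intr (intr φ)))
  | know_intr (i : A) (φ : Formula P A) : Provable (imp (know i φ) (intr φ))
  | r1 (φ : Formula P A) (p : P) : Provable (iff (ann φ (var p)) (imp (intr φ) (var p)))
  | r2 (φ ψ : Formula P A) :
      Provable (iff (ann φ (neg ψ)) (imp (intr φ) (neg (ann φ ψ))))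
  | r3 (φ ψ χ : Formula P A) :
      Provable (iff (ann φ (and ψ χ)) (and (ann φ ψ) (ann φ χ)))
  | r4 (φ ψ : Formula P A) :
      Provable (iff (ann φ (intr ψ)) (imp (intr φ) (intr (ann φ ψ))))
  | r5 (i : A) (φ ψ : Formula P A) :
      Provable (iff (ann φ (know i ψ)) (imp (intr φ) (know i (ann φ ψ))))
  | r6 (φ ψ χ : Formula P A) :
      Provable (iff (ann φ (ann ψ χ)) (ann (neg (ann φ (neg (intr ψ)))) χ))
  | r7 (φ χ : Formula P A) (hχ : χ.BoxFree) : Provable (imp (box φ) (ann χ φ))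
  | dr1 {φ ψ : Formula P A} (h₁ : Provable φ) (h₂ : Provable (imp φ ψ)) : Provable ψ
  | dr2 (i : A) {φ : Formula P A} (h : Provable φ) : Provable (know i φ)
  | dr3 {φ : Formula P A} (h : Provable φ) : Provable (intr φ)
  | dr4 (ψ : Formula P A) {φ : Formula P A} (h : Provable φ) : Provable (ann ψ φ)
  | dr5 (ξ : NecForm P A) (χ : Formula P A)
      (h : ∀ ψ : Formula P A, ψ.BoxFree → Provable (ξ.fill (ann ψ χ))) :
      Provable (ξ.fill (box χ))

end APAL

/-!
Completeness is proved with a canonical model. Since the rule for `□` is infinitary, the points are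
maximal *theories*: consistent complete sets of formulas that contain all theorems and are closed
under modus ponens and under the infinitary rule. As there are only countably many formulas and
necessity forms, the Rasiowa–Sikorski lemma gives a Lindenbaum lemma (`IsTheory.exists_isMaxTheory`):
a theory that omits `φ` is contained in a maximal theory that omits `φ`.

A set of maximal theories is declared open when it is closed under the relation
`∀ α, int α ∈ S → α ∈ T`, which is a preorder by the S4 axioms for `int`. The neighbourhood of a
point for agent `i` is its class for the equivalence "the same formulas `K_i α` hold"; it is open
because `K_i α → int α` is an axiom. The neighbourhood functions are the restrictions of this one
function to open sets.

Say that membership and truth agree on `φ` when `φ` is a member of exactly the points at which it is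
true (`Agree`). The difficulty is announcements, because `[φ]ψ` is evaluated at a restricted
neighbourhood function. The reduction axioms, with their semantic counterparts `sat_ann_*`, show
that agreement on `φ` yields agreement on `[φ]ψ`. This goes by structural induction on `ψ`, with `φ`
arbitrary, so that an announcement `[φ][ψ]χ` can be contracted to `[¬[φ]¬int ψ]χ`. When `ψ = □χ`, the
induction needs agreement on `[φ][η]χ` for all box-free `η`, hence on `[φ]η`. Box-free formulas are
therefore treated first; no measure on formulas is needed.
-/

namespace APAL

open Formula

/-! ### Countability of the language -/

section Countable

variable {P : Type u} {A : Type v}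

/-- A numerical code of a formula, given codes of variables and agents. -/
def Formula.code (f : P → ℕ) (g : A → ℕ) : Formula P A → ℕ
  | var p => Nat.pair 0 (f p)
  | neg φ => Nat.pair 1 (φ.code f g)
  | and φ ψ => Nat.pair 2 (Nat.pair (φ.code f g) (ψ.code f g))
  | know i φ => Nat.pair 3 (Nat.pair (g i) (φ.code f g))
  | intr φ => Nat.pair 4 (φ.code f g)
  | ann φ ψ => Nat.pair 5 (Nat.pair (φ.code f g) (ψ.code f g))
  | box φ => Nat.pair 6 (φ.code f g)

theorem Formula.code_injective {f : P → ℕ} {g : A → ℕ} (hf : f.Injective) (hg : g.Injective) :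
    Function.Injective (Formula.code f g) := by
  intro φ
  induction φ <;> intro ψ h <;> cases ψ <;>
    simp only [code, Nat.pair_eq_pair, hf.eq_iff, hg.eq_iff] at h <;> grind

instance [Countable P] [Countable A] : Countable (Formula P A) := by
  obtain ⟨f, hf⟩ := exists_injective_nat P
  obtain ⟨g, hg⟩ := exists_injective_nat A
  exact (Formula.code_injective hf hg).countable

/-- A numerical code of a necessity form, given codes of agents and formulas. -/
def NecForm.code (g : A → ℕ) (f : Formula P A → ℕ) : NecForm P A → ℕ
  | hole => Nat.pair 0 0
  | imp φ ξ => Nat.pair 1 (Nat.pair (f φ) (ξ.code g f))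
  | know i ξ => Nat.pair 2 (Nat.pair (g i) (ξ.code g f))
  | intr ξ => Nat.pair 3 (ξ.code g f)
  | ann φ ξ => Nat.pair 4 (Nat.pair (f φ) (ξ.code g f))

theorem NecForm.code_injective {g : A → ℕ} {f : Formula P A → ℕ} (hg : g.Injective)
    (hf : f.Injective) : Function.Injective (NecForm.code g f) := by
  intro ξ
  induction ξ <;> intro ζ h <;> cases ζ <;>
    simp only [code, Nat.pair_eq_pair, hf.eq_iff, hg.eq_iff] at h <;> grind

instance [Countable P] [Countable A] : Countable (NecForm P A) := by
  obtain ⟨f, hf⟩ := exists_injective_nat (Formula P A)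
  obtain ⟨g, hg⟩ := exists_injective_nat A
  exact (NecForm.code_injective hg hf).countable

end Countable

/-! ### Theories -/

section Theories

variable {P : Type u} {A : Type v}

/-- `s → t` for propositional formulas, matching `Formula.imp`. -/
def PropFormula.imp (s t : PropFormula) : PropFormula := neg (and s (neg t))

/-- The substitution of three formulas for the letters `0`, `1`, `2`. -/
def substThree (φ ψ χ : Formula P A) : ℕ → Formula P A
  | 0 => φ
  | 1 => ψ
  | _ => χ

/-- A theory: a set of formulas that contains all theorems and is closed under modus ponens and
under the infinitary rule for `□`. It need not be closed under the necessitation rules, nor be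
consistent. -/
structure IsTheory (T : Set (Formula P A)) : Prop where
  provable : ∀ {φ}, Provable φ → φ ∈ T
  mp : ∀ {φ ψ}, φ ∈ T → imp φ ψ ∈ T → ψ ∈ T
  omega : ∀ (ξ : NecForm P A) (χ : Formula P A),
    (∀ ψ : Formula P A, ψ.BoxFree → ξ.fill (ann ψ χ) ∈ T) → ξ.fill (box χ) ∈ T

/-- A maximal theory: a theory that contains exactly one of `φ` and `¬φ` for each `φ`. -/
structure IsMaxTheory (T : Set (Formula P A)) : Prop extends IsTheory T where
  neg_mem_iff : ∀ {φ}, neg φ ∈ T ↔ φ ∉ T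

theorem isTheory_provable : IsTheory {φ : Formula P A | Provable φ} :=
  ⟨fun h => h, fun h₁ h₂ => .dr1 h₁ h₂, fun ξ χ h => .dr5 ξ χ h⟩

namespace IsTheory

variable {T : Set (Formula P A)} (hT : IsTheory T)

include hT

theorem taut (t : PropFormula) (ht : ∀ e : ℕ → Prop, t.eval e) (φ ψ χ : Formula P A) :
    t.inst (substThree φ ψ χ) ∈ T :=
  hT.provable (.taut t ht _)

open PropFormula in
theorem imp_self_mem (φ : Formula P A) : Formula.imp φ φ ∈ T :=
  hT.taut (.imp (letter 0) (letter 0)) (by simp [PropFormula.imp, eval]) φ φ φ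

open PropFormula in
theorem imp_mem_of_mem (φ : Formula P A) {ψ : Formula P A} (h : ψ ∈ T) :
    Formula.imp φ ψ ∈ T :=
  hT.mp h <| hT.taut (.imp (letter 1) (.imp (letter 0) (letter 1)))
    (by simp only [PropFormula.imp, eval]; tauto) φ ψ ψ

open PropFormula in
theorem imp_mp {φ ψ χ : Formula P A} (h₁ : Formula.imp φ ψ ∈ T)
    (h₂ : Formula.imp φ (Formula.imp ψ χ) ∈ T) : Formula.imp φ χ ∈ T :=
  hT.mp h₁ <| hT.mp h₂ <| hT.taut
    (.imp (.imp (letter 0) (.imp (letter 1) (letter 2)))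
      (.imp (.imp (letter 0) (letter 1)) (.imp (letter 0) (letter 2))))
    (by simp only [PropFormula.imp, eval]; tauto) φ ψ χ

open PropFormula in
/-- Proof by contradiction. -/
theorem mem_of_neg_imp {φ ψ : Formula P A} (h₁ : Formula.imp (.neg φ) ψ ∈ T)
    (h₂ : Formula.imp (.neg φ) (.neg ψ) ∈ T) : φ ∈ T :=
  hT.mp h₁ <| hT.mp h₂ <| hT.taut
    (.imp (.imp (neg (letter 0)) (neg (letter 1)))
      (.imp (.imp (neg (letter 0)) (letter 1)) (letter 0)))
    (by simp only [PropFormula.imp, eval]; tauto) φ ψ ψ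

open PropFormula in
theorem and_mem_iff {φ ψ : Formula P A} : Formula.and φ ψ ∈ T ↔ φ ∈ T ∧ ψ ∈ T := by
  refine ⟨fun h => ⟨hT.mp h ?_, hT.mp h ?_⟩, fun h => hT.mp h.2 (hT.mp h.1 ?_)⟩
  · exact hT.taut (.imp (and (letter 0) (letter 1)) (letter 0))
      (by simp only [PropFormula.imp, eval]; tauto) φ ψ ψ
  · exact hT.taut (.imp (and (letter 0) (letter 1)) (letter 1))
      (by simp only [PropFormula.imp, eval]; tauto) φ ψ ψ
  · exact hT.taut (.imp (letter 0) (.imp (letter 1) (and (letter 0) (letter 1))))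
      (by simp only [PropFormula.imp, eval]; tauto) φ ψ ψ

/-- Closure under the infinitary rule passes to this set because `φ → ξ(♯)` is again a necessity
form; the same remark applies to `K_i` and `int` below. -/
theorem adjoin (φ : Formula P A) : IsTheory {ψ | Formula.imp φ ψ ∈ T} where
  provable h := hT.imp_mem_of_mem φ (hT.provable h)
  mp h₁ h₂ := hT.imp_mp h₁ h₂
  omega ξ χ h := hT.omega (.imp φ ξ) χ h

theorem know (i : A) : IsTheory {φ | Formula.know i φ ∈ T} where
  provable h := hT.provable (.dr2 i h)
  mp h₁ h₂ := hT.mp h₁ (hT.mp h₂ (hT.provable (.know_K i _ _)))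
  omega ξ χ h := hT.omega (.know i ξ) χ h

theorem intr : IsTheory {φ | Formula.intr φ ∈ T} where
  provable h := hT.provable (.dr3 h)
  mp h₁ h₂ := hT.mp h₁ (hT.mp h₂ (hT.provable (.intr_K _ _)))
  omega ξ χ h := hT.omega (.intr ξ) χ h

end IsTheory

/-! ### The Lindenbaum lemma -/

/-- Consistent theories, ordered by inclusion. -/
abbrev ConsTheory (P : Type u) (A : Type v) : Type (max u v) :=
  {T : Set (Formula P A) // IsTheory T ∧ ∀ φ, φ ∈ T → neg φ ∉ T}

theorem IsTheory.exists_consTheory {T : Set (Formula P A)} (hT : IsTheory T) {φ : Formula P A}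
    (h : φ ∉ T) : ∃ S : ConsTheory P A, T ⊆ S.1 ∧ neg φ ∈ S.1 :=
  ⟨⟨_, hT.adjoin (neg φ), fun _ h₁ h₂ => h (hT.mem_of_neg_imp h₁ h₂)⟩,
    fun _ h' => hT.imp_mem_of_mem _ h', hT.imp_self_mem _⟩

/-- The consistent theories that decide `φ`. -/
def decideCofinal (φ : Formula P A) : Order.Cofinal (ConsTheory P A) where
  carrier := {T | φ ∈ T.1 ∨ neg φ ∈ T.1}
  isCofinal T := by
    by_cases h : φ ∈ T.1
    · exact ⟨T, .inl h, le_rfl⟩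
    · obtain ⟨S, hS, hφ⟩ := T.2.1.exists_consTheory h
      exact ⟨S, .inr hφ, hS⟩

/-- The consistent theories that contain `ξ(□χ)` or refute some `ξ([ψ]χ)` with `ψ` box-free. -/
def witnessCofinal (ξ : NecForm P A) (χ : Formula P A) : Order.Cofinal (ConsTheory P A) where
  carrier := {T | ξ.fill (box χ) ∈ T.1 ∨
    ∃ ψ : Formula P A, ψ.BoxFree ∧ neg (ξ.fill (ann ψ χ)) ∈ T.1}
  isCofinal T := by
    by_cases h : ξ.fill (box χ) ∈ T.1
    · exact ⟨T, .inl h, le_rfl⟩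
    · obtain ⟨ψ, hψ, hn⟩ : ∃ ψ : Formula P A, ψ.BoxFree ∧ ξ.fill (ann ψ χ) ∉ T.1 := by
        by_contra! hc
        exact h (T.2.1.omega ξ χ hc)
      obtain ⟨S, hS, hφ⟩ := T.2.1.exists_consTheory hn
      exact ⟨S, .inr ⟨ψ, hψ, hφ⟩, hS⟩

/-- The Lindenbaum lemma. The maximal theory is the union of an ideal of consistent theories that is
generic for the sets `decideCofinal` and `witnessCofinal`; the latter secure closure under the
infinitary rule, which unions of chains need not inherit. -/
theorem IsTheory.exists_isMaxTheory [Countable P] [Countable A] {T : Set (Formula P A)}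
    (hT : IsTheory T) {φ : Formula P A} (h : φ ∉ T) :
    ∃ M : Set (Formula P A), IsMaxTheory M ∧ T ⊆ M ∧ φ ∉ M := by
  obtain ⟨S, hS, hφ⟩ := hT.exists_consTheory h
  let ι := Formula P A ⊕ (NecForm P A × Formula P A)
  let _ : Encodable ι := Encodable.ofCountable ι
  let 𝒟 : ι → Order.Cofinal (ConsTheory P A) :=
    Sum.elim decideCofinal fun t => witnessCofinal t.1 t.2
  let I := Order.idealOfCofinals S 𝒟
  have hSI : S ∈ I := Order.mem_idealOfCofinals S 𝒟
  have hdir : ∀ {α β : Formula P A}, (∃ U ∈ I, α ∈ U.1) → (∃ U ∈ I, β ∈ U.1) →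
      ∃ U ∈ I, α ∈ U.1 ∧ β ∈ U.1 := by
    rintro α β ⟨U, hU, hα⟩ ⟨W, hW, hβ⟩
    obtain ⟨Z, hZ, hUZ, hWZ⟩ := I.directed U hU W hW
    exact ⟨Z, hZ, hUZ hα, hWZ hβ⟩
  have hcons : ∀ {α : Formula P A}, (∃ U ∈ I, α ∈ U.1) → ¬ ∃ U ∈ I, neg α ∈ U.1 := by
    intro α h₁ h₂
    obtain ⟨U, -, h₃, h₄⟩ := hdir h₁ h₂
    exact U.2.2 α h₃ h₄
  refine ⟨{α | ∃ U ∈ I, α ∈ U.1}, ⟨⟨?_, ?_, ?_⟩, ?_⟩, fun α hα => ⟨S, hSI, hS hα⟩,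
    fun hc => hcons hc ⟨S, hSI, hφ⟩⟩
  · exact fun hα => ⟨S, hSI, S.2.1.provable hα⟩
  · intro α β h₁ h₂
    obtain ⟨U, hU, h₃, h₄⟩ := hdir h₁ h₂
    exact ⟨U, hU, U.2.1.mp h₃ h₄⟩
  · intro ξ χ hall
    obtain ⟨U, hU | ⟨ψ, hψ, hU⟩, hUI⟩ := Order.cofinal_meets_idealOfCofinals S 𝒟 (.inr (ξ, χ))
    · exact ⟨U, hUI, hU⟩
    · exact absurd ⟨U, hUI, hU⟩ (hcons (hall ψ hψ))
  · intro α
    refine ⟨fun h₁ h₂ => hcons h₂ h₁, fun h₁ => ?_⟩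
    obtain ⟨U, hU | hU, hUI⟩ := Order.cofinal_meets_idealOfCofinals S 𝒟 (.inl α)
    · exact absurd ⟨U, hUI, hU⟩ h₁
    · exact ⟨U, hUI, hU⟩

/-! ### Membership in maximal theories -/

namespace IsMaxTheory

variable {T : Set (Formula P A)} (hT : IsMaxTheory T)

include hT

theorem and_mem_iff {φ ψ : Formula P A} : Formula.and φ ψ ∈ T ↔ φ ∈ T ∧ ψ ∈ T :=
  hT.toIsTheory.and_mem_iff

theorem imp_mem_iff {φ ψ : Formula P A} : imp φ ψ ∈ T ↔ (φ ∈ T → ψ ∈ T) := by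
  rw [imp, hT.neg_mem_iff, hT.and_mem_iff, hT.neg_mem_iff]
  tauto

theorem mem_of_provable_imp {φ ψ : Formula P A} (h : Provable (imp φ ψ)) (hφ : φ ∈ T) : ψ ∈ T :=
  hT.mp hφ (hT.provable h)

theorem mem_iff_of_provable_iff {φ ψ : Formula P A} (h : Provable (Formula.iff φ ψ)) :
    φ ∈ T ↔ ψ ∈ T := by
  have := hT.and_mem_iff.1 (hT.provable h)
  exact ⟨fun h => hT.mp h this.1, fun h => hT.mp h this.2⟩

theorem ann_var_mem_iff {φ : Formula P A} {p : P} :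
    ann φ (var p) ∈ T ↔ (intr φ ∈ T → var p ∈ T) := by
  rw [hT.mem_iff_of_provable_iff (.r1 φ p), hT.imp_mem_iff]

theorem ann_neg_mem_iff {φ ψ : Formula P A} :
    ann φ (neg ψ) ∈ T ↔ (intr φ ∈ T → ann φ ψ ∉ T) := by
  rw [hT.mem_iff_of_provable_iff (.r2 φ ψ), hT.imp_mem_iff, hT.neg_mem_iff]

theorem ann_and_mem_iff {φ ψ χ : Formula P A} :
    ann φ (Formula.and ψ χ) ∈ T ↔ ann φ ψ ∈ T ∧ ann φ χ ∈ T := by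
  rw [hT.mem_iff_of_provable_iff (.r3 φ ψ χ), hT.and_mem_iff]

theorem ann_ann_mem_iff {φ ψ χ : Formula P A} :
    ann φ (ann ψ χ) ∈ T ↔ ann (neg (ann φ (neg (intr ψ)))) χ ∈ T :=
  hT.mem_iff_of_provable_iff (.r6 φ ψ χ)

/-- After an announcement that cannot be made, everything holds. -/
theorem ann_mem_of_intr_notMem (ψ : Formula P A) {φ : Formula P A} (h : intr φ ∉ T) :
    ann φ ψ ∈ T := by
  -- A composite announcement whose first part cannot be made cannot be made.
  have hcomp : ∀ {φ : Formula P A} (ψ : Formula P A), intr φ ∉ T →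
      intr (neg (ann φ (neg (intr ψ)))) ∉ T := by
    intro φ ψ h hc
    exact hT.neg_mem_iff.1 (hT.mem_of_provable_imp (.intr_T _) hc)
      (hT.ann_neg_mem_iff.2 fun h' => absurd h' h)
  induction ψ generalizing φ with
  | var p => exact hT.ann_var_mem_iff.2 fun h' => absurd h' h
  | neg ψ => exact hT.ann_neg_mem_iff.2 fun h' => absurd h' h
  | and ψ χ ihψ ihχ => exact hT.ann_and_mem_iff.2 ⟨ihψ h, ihχ h⟩
  | know i ψ =>
    rw [hT.mem_iff_of_provable_iff (.r5 i φ ψ), hT.imp_mem_iff]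
    exact fun h' => absurd h' h
  | intr ψ =>
    rw [hT.mem_iff_of_provable_iff (.r4 φ ψ), hT.imp_mem_iff]
    exact fun h' => absurd h' h
  | ann ψ χ _ ihχ => exact hT.ann_ann_mem_iff.2 (ihχ (hcomp ψ h))
  | box χ ih => exact hT.omega (.ann φ .hole) χ fun η _ => hT.ann_ann_mem_iff.2 (ih (hcomp η h))

/-- Announcements distribute over implication. -/
theorem ann_mp {φ ψ χ : Formula P A} (h₁ : ann φ ψ ∈ T) (h₂ : ann φ (imp ψ χ) ∈ T) :
    ann φ χ ∈ T := by
  by_cases h : intr φ ∈ T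
  · rw [imp, hT.ann_neg_mem_iff, hT.ann_and_mem_iff, hT.ann_neg_mem_iff] at h₂
    have := h₂ h
    tauto
  · exact hT.ann_mem_of_intr_notMem χ h

theorem box_mem_iff {χ : Formula P A} :
    box χ ∈ T ↔ ∀ η : Formula P A, η.BoxFree → ann η χ ∈ T :=
  ⟨fun h η hη => hT.mem_of_provable_imp (.r7 χ η hη) h, hT.omega .hole χ⟩

theorem ann_box_mem_iff {φ χ : Formula P A} :
    ann φ (box χ) ∈ T ↔ ∀ η : Formula P A, η.BoxFree → ann φ (ann η χ) ∈ T :=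
  ⟨fun h η hη => hT.ann_mp h (hT.provable (.dr4 φ (.r7 χ η hη))), hT.omega (.ann φ .hole) χ⟩

end IsMaxTheory

end Theories

/-! ### Restrictions and semantic reduction laws -/

section Semantics

open TopologicalSpace

variable {P : Type u} {A : Type v} {X : Type w} [TopologicalSpace X]

theorem restrict_restrict (θ : X →. (A → Opens X)) (U W : Opens X) :
    restrict (restrict θ U) W = restrict θ (U ⊓ W) := by
  apply PFun.ext'
  · intro x
    exact and_assoc
  · intro x _ _
    funext i
    exact inf_assoc _ _ _

/-- The restrictions of a neighbourhood function to the open sets form a neighbourhood function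
set. -/
theorem isNbhdFunSet_range_restrict (θ : X →. (A → Opens X))
    (h₁ : ∀ x hx i, x ∈ θ.fn x hx i) (h₂ : ∀ x hx i, (θ.fn x hx i : Set X) ⊆ θ.Dom)
    (h₃ : ∀ x y hx hy i, y ∈ θ.fn x hx i → θ.fn x hx i = θ.fn y hy i) :
    IsNbhdFunSet (Set.range (restrict θ)) where
  mem_self := by
    rintro _ ⟨U, rfl⟩ x hx i
    exact ⟨h₁ x hx.1 i, hx.2⟩
  subset_dom := by
    rintro _ ⟨U, rfl⟩ x hx i y hy
    exact ⟨h₂ x hx.1 i hy.1, hy.2⟩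
  eq_of_mem := by
    rintro _ ⟨U, rfl⟩ x y hx hy i h
    exact congrArg (· ⊓ U) (h₃ x y hx.1 hy.1 i h.1)
  restrict_mem := by
    rintro _ ⟨U, rfl⟩ W
    exact ⟨U ⊓ W, (restrict_restrict θ U W).symm⟩

variable (V : P → Set X) (θ : X →. (A → Opens X))

/-- The open set `Int ⟦φ⟧^θ`. -/
def intSet (φ : Formula P A) : Opens X :=
  ⟨interior {y | y ∈ θ.Dom ∧ Sat V θ y φ}, isOpen_interior⟩

variable {V θ} {x : X} {φ ψ χ : Formula P A}

theorem mem_dom_of_mem_intSet (h : x ∈ intSet V θ φ) : x ∈ θ.Dom :=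
  (interior_subset h).1

@[simp] theorem sat_var {p : P} : Sat V θ x (var p) ↔ x ∈ V p := by rw [Sat]

@[simp] theorem sat_neg : Sat V θ x (neg φ) ↔ ¬ Sat V θ x φ := by rw [Sat]

@[simp] theorem sat_and : Sat V θ x (Formula.and φ ψ) ↔ Sat V θ x φ ∧ Sat V θ x ψ := by rw [Sat]

@[simp] theorem sat_imp : Sat V θ x (imp φ ψ) ↔ (Sat V θ x φ → Sat V θ x ψ) := by
  simp only [imp, sat_neg, sat_and, not_and, not_not]

theorem sat_know {i : A} : Sat V θ x (know i φ) ↔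
    ∀ hx : x ∈ θ.Dom, ∀ y ∈ θ.fn x hx i, Sat V θ y φ := by rw [Sat]

theorem sat_intr : Sat V θ x (intr φ) ↔ x ∈ intSet V θ φ := by rw [Sat]; rfl

theorem sat_ann : Sat V θ x (ann φ ψ) ↔
    (x ∈ intSet V θ φ → Sat V (restrict θ (intSet V θ φ)) x ψ) := by
  rw [Sat, sat_intr]; rfl

theorem sat_box : Sat V θ x (box φ) ↔
    ∀ ψ : Formula P A, ψ.BoxFree → Sat V θ x (ann ψ φ) := by rw [Sat]

theorem sat_ann_var {p : P} :
    Sat V θ x (ann φ (var p)) ↔ Sat V θ x (imp (intr φ) (var p)) := by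
  simp only [sat_ann, sat_imp, sat_intr, sat_var]

theorem sat_ann_neg :
    Sat V θ x (ann φ (neg ψ)) ↔ Sat V θ x (imp (intr φ) (neg (ann φ ψ))) := by
  simp only [sat_ann, sat_imp, sat_intr, sat_neg]
  tauto

theorem sat_ann_and : Sat V θ x (ann φ (Formula.and ψ χ)) ↔
    Sat V θ x (Formula.and (ann φ ψ) (ann φ χ)) := by
  simp only [sat_ann, sat_and]
  tauto

theorem sat_ann_know {i : A} :
    Sat V θ x (ann φ (know i ψ)) ↔ Sat V θ x (imp (intr φ) (know i (ann φ ψ))) := by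
  simp only [sat_ann, sat_imp, sat_intr, sat_know]
  exact ⟨fun h hx hd y hy hyφ => h hx ⟨hd, hx⟩ y ⟨hy, hyφ⟩,
    fun h hx hd y hy => h hx hd.1 y hy.1 hy.2⟩

theorem sat_ann_intr :
    Sat V θ x (ann φ (intr ψ)) ↔ Sat V θ x (imp (intr φ) (intr (ann φ ψ))) := by
  simp only [sat_ann, sat_imp, sat_intr]
  refine forall_congr' fun hx => ⟨fun h => ?_, fun h => ?_⟩
  · refine interior_mono (fun y hy => ?_) h
    exact ⟨hy.1.1, sat_ann.2 fun _ => hy.2⟩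
  · refine mem_interior.2 ⟨intSet V θ φ ⊓ intSet V θ (ann φ ψ), ?_,
      (intSet V θ φ ⊓ intSet V θ (ann φ ψ)).isOpen, hx, h⟩
    intro y hy
    exact ⟨⟨mem_dom_of_mem_intSet hy.1, hy.1⟩, sat_ann.1 (interior_subset hy.2).2 hy.1⟩

theorem sat_ann_ann : Sat V θ x (ann φ (ann ψ χ)) ↔
    Sat V θ x (ann (neg (ann φ (neg (intr ψ)))) χ) := by
  have hle : intSet V (restrict θ (intSet V θ φ)) ψ ≤ intSet V θ φ :=
    fun y hy => (interior_subset hy).1.2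
  -- The composite announcement restricts to the same open set as the two announcements in turn.
  have key : intSet V θ (neg (ann φ (neg (intr ψ)))) =
      intSet V (restrict θ (intSet V θ φ)) ψ := by
    have hset : {y | y ∈ θ.Dom ∧ Sat V θ y (neg (ann φ (neg (intr ψ))))} =
        (intSet V (restrict θ (intSet V θ φ)) ψ : Set X) := by
      ext y
      simp only [Set.mem_ofPred_eq, sat_neg, sat_ann, sat_intr, SetLike.mem_coe, not_forall,
        not_not, exists_prop]
      exact ⟨fun h => h.2.2, fun h => ⟨mem_dom_of_mem_intSet (hle h), hle h, h⟩⟩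
    apply Opens.ext
    change interior _ = _
    rw [hset, (Opens.isOpen _).interior_eq]
  rw [sat_ann (ψ := χ), key, sat_ann, sat_ann, restrict_restrict, inf_eq_right.2 hle]
  exact ⟨fun h hx => h (hle hx) hx, fun h _ hx => h hx⟩

theorem sat_ann_box : Sat V θ x (ann φ (box χ)) ↔
    ∀ η : Formula P A, η.BoxFree → Sat V θ x (ann φ (ann η χ)) := by
  simp only [sat_ann (ψ := box χ), sat_ann (φ := φ) (ψ := ann _ χ), sat_box]
  tauto

end Semantics

/-! ### The canonical model -/

section Canonical

open TopologicalSpace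

variable (P : Type u) (A : Type v)

/-- The type of maximal theories. -/
abbrev MaxTheory : Type (max u v) := {T : Set (Formula P A) // IsMaxTheory T}

variable [Countable P] [Countable A]

/-- The points of the canonical model: the maximal theories, moved to the universe `w`. This is
possible because there are only countably many formulas. -/
def CanonicalPoint : Type w := Shrink.{w} (MaxTheory P A)

variable {P A}

namespace CanonicalPoint

/-- The maximal theory that a point stands for. -/
noncomputable def thy (x : CanonicalPoint.{u, v, w} P A) : Set (Formula P A) :=
  ((equivShrink.{w} (MaxTheory P A)).symm x).1

theorem isMaxTheory_thy (x : CanonicalPoint.{u, v, w} P A) : IsMaxTheory x.thy :=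
  ((equivShrink.{w} (MaxTheory P A)).symm x).2

theorem exists_thy_eq {T : Set (Formula P A)} (hT : IsMaxTheory T) :
    ∃ x : CanonicalPoint.{u, v, w} P A, x.thy = T :=
  ⟨equivShrink.{w} (MaxTheory P A) ⟨T, hT⟩,
    congrArg Subtype.val ((equivShrink.{w} (MaxTheory P A)).symm_apply_apply ⟨T, hT⟩)⟩

theorem exists_notMem_thy {T : Set (Formula P A)} (hT : IsTheory T) {φ : Formula P A}
    (h : φ ∉ T) : ∃ x : CanonicalPoint.{u, v, w} P A, T ⊆ x.thy ∧ φ ∉ x.thy := by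
  obtain ⟨M, hM, hTM, hφ⟩ := hT.exists_isMaxTheory h
  obtain ⟨x, rfl⟩ := exists_thy_eq.{u, v, w} hM
  exact ⟨x, hTM, hφ⟩

/-- The accessibility relation of `int`. -/
def IntRel (x y : CanonicalPoint.{u, v, w} P A) : Prop :=
  ∀ α, intr α ∈ x.thy → α ∈ y.thy

theorem IntRel.refl (x : CanonicalPoint.{u, v, w} P A) : IntRel x x :=
  fun α h => x.isMaxTheory_thy.mem_of_provable_imp (.intr_T α) h

theorem IntRel.trans {x y z : CanonicalPoint.{u, v, w} P A} (hxy : IntRel x y)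
    (hyz : IntRel y z) : IntRel x z :=
  fun α h => hyz α (hxy _ (x.isMaxTheory_thy.mem_of_provable_imp (.intr_4 α) h))

/-- The points `x` and `y` are indistinguishable for agent `i`. -/
def KnowRel (i : A) (x y : CanonicalPoint.{u, v, w} P A) : Prop :=
  ∀ α, know i α ∈ x.thy ↔ know i α ∈ y.thy

/-- One inclusion suffices, by the introspection axioms. -/
theorem KnowRel.of_imp {i : A} {x y : CanonicalPoint.{u, v, w} P A}
    (h : ∀ α, know i α ∈ x.thy → α ∈ y.thy) : KnowRel i x y := by
  have hx := x.isMaxTheory_thy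
  have hy := y.isMaxTheory_thy
  refine fun α => ⟨fun hα => h _ (hx.mem_of_provable_imp (.know_4 i α) hα), fun hα => ?_⟩
  by_contra hn
  exact hy.neg_mem_iff.1
    (h _ (hx.mem_of_provable_imp (.know_5 i α) (hx.neg_mem_iff.2 hn))) hα

theorem IntRel.knowRel {x y : CanonicalPoint.{u, v, w} P A} (h : IntRel x y) (i : A) :
    KnowRel i x y :=
  .of_imp fun α hα => h α (x.isMaxTheory_thy.mem_of_provable_imp (.know_intr i α) hα)

/-- The open sets are those closed under `IntRel`. -/
instance : TopologicalSpace (CanonicalPoint.{u, v, w} P A) where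
  IsOpen U := ∀ x ∈ U, ∀ y, IntRel x y → y ∈ U
  isOpen_univ _ _ _ _ := trivial
  isOpen_inter U W hU hW x hx y hxy := ⟨hU x hx.1 y hxy, hW x hx.2 y hxy⟩
  isOpen_sUnion 𝒰 h𝒰 x := by
    rintro ⟨U, hU, hx⟩ y hxy
    exact ⟨U, hU, h𝒰 U hU x hx y hxy⟩

theorem mem_interior_iff {x : CanonicalPoint.{u, v, w} P A}
    {S : Set (CanonicalPoint.{u, v, w} P A)} : x ∈ interior S ↔ ∀ y, IntRel x y → y ∈ S := by
  rw [mem_interior]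
  constructor
  · rintro ⟨U, hUS, hU, hx⟩ y hxy
    exact hUS (hU x hx y hxy)
  · intro h
    exact ⟨{y | IntRel x y}, h, fun _ hy _ hyz => hy.trans hyz, IntRel.refl x⟩

/-- The canonical neighbourhood function, defined everywhere. -/
def nbhd : CanonicalPoint.{u, v, w} P A →. (A → Opens (CanonicalPoint.{u, v, w} P A)) :=
  fun x => .some fun i =>
    ⟨{y | KnowRel i x y}, fun _ hy _ hyz α => (hy α).trans (hyz.knowRel i α)⟩

/-- The canonical valuation. -/
def val (p : P) : Set (CanonicalPoint.{u, v, w} P A) := {x | var p ∈ x.thy}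

end CanonicalPoint

open CanonicalPoint

/-- The canonical model. -/
def canonicalModel [Nonempty (CanonicalPoint.{u, v, w} P A)] : TopoModel.{u, v, w} P A where
  X := CanonicalPoint.{u, v, w} P A
  Φ := Set.range (restrict nbhd)
  isNbhdFunSet := isNbhdFunSet_range_restrict nbhd (fun _ _ _ _ => Iff.rfl)
    (fun _ _ _ _ _ => trivial) fun _ _ _ _ _ h => by
      ext z
      exact forall_congr' fun α => by rw [h α]
  V := val

/-! ### The truth lemma -/

/-- Membership and truth at the canonical neighbourhood function agree on `φ`. -/
def Agree (φ : Formula P A) : Prop :=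
  ∀ x : CanonicalPoint.{u, v, w} P A, φ ∈ x.thy ↔ Sat val nbhd x φ

namespace Agree

variable {φ ψ χ : Formula P A}

theorem var (p : P) : Agree.{u, v, w} (A := A) (var p) := fun x => by
  rw [sat_var]; rfl

theorem neg (h : Agree.{u, v, w} φ) : Agree.{u, v, w} (neg φ) := fun x => by
  rw [x.isMaxTheory_thy.neg_mem_iff, sat_neg, h x]

theorem and (hφ : Agree.{u, v, w} φ) (hψ : Agree.{u, v, w} ψ) :
    Agree.{u, v, w} (Formula.and φ ψ) := fun x => by
  rw [x.isMaxTheory_thy.and_mem_iff, sat_and, hφ x, hψ x]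

theorem imp (hφ : Agree.{u, v, w} φ) (hψ : Agree.{u, v, w} ψ) :
    Agree.{u, v, w} (Formula.imp φ ψ) := (hφ.and hψ.neg).neg

theorem know (i : A) (h : Agree.{u, v, w} φ) : Agree.{u, v, w} (know i φ) := fun x => by
  rw [sat_know]
  constructor
  · intro hx _ y hy
    exact (h y).1 (y.isMaxTheory_thy.mem_of_provable_imp (.know_T i φ) ((hy φ).1 hx))
  · intro hx
    by_contra hn
    obtain ⟨y, hy, hφ⟩ := exists_notMem_thy.{u, v, w} (x.isMaxTheory_thy.toIsTheory.know i) hn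
    exact hφ ((h y).2 (hx trivial y (KnowRel.of_imp hy)))

theorem intr (h : Agree.{u, v, w} φ) : Agree.{u, v, w} (intr φ) := fun x => by
  rw [sat_intr]
  refine Iff.trans ?_ mem_interior_iff.symm
  constructor
  · exact fun hx y hxy => ⟨trivial, (h y).1 (hxy φ hx)⟩
  · intro hx
    by_contra hn
    obtain ⟨y, hy, hφ⟩ := exists_notMem_thy.{u, v, w} x.isMaxTheory_thy.toIsTheory.intr hn
    exact hφ ((h y).2 (hx y hy).2)

/-- Agreement transfers along equivalences that are both provable and semantically valid. -/
theorem of_iff (hp : Provable (Formula.iff φ ψ))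
    (hs : ∀ x : CanonicalPoint.{u, v, w} P A, Sat val nbhd x φ ↔ Sat val nbhd x ψ)
    (h : Agree.{u, v, w} ψ) : Agree.{u, v, w} φ := fun x => by
  rw [x.isMaxTheory_thy.mem_iff_of_provable_iff hp, hs x, h x]

theorem ann_var (p : P) (hφ : Agree.{u, v, w} φ) : Agree.{u, v, w} (ann φ (.var p)) :=
  of_iff (.r1 φ p) (fun _ => sat_ann_var) (hφ.intr.imp (.var p))

theorem ann_neg (hφ : Agree.{u, v, w} φ) (h : Agree.{u, v, w} (ann φ ψ)) :
    Agree.{u, v, w} (ann φ (.neg ψ)) :=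
  of_iff (.r2 φ ψ) (fun _ => sat_ann_neg) (hφ.intr.imp h.neg)

theorem ann_and (hψ : Agree.{u, v, w} (ann φ ψ)) (hχ : Agree.{u, v, w} (ann φ χ)) :
    Agree.{u, v, w} (ann φ (.and ψ χ)) :=
  of_iff (.r3 φ ψ χ) (fun _ => sat_ann_and) (hψ.and hχ)

theorem ann_know (i : A) (hφ : Agree.{u, v, w} φ) (h : Agree.{u, v, w} (ann φ ψ)) :
    Agree.{u, v, w} (ann φ (.know i ψ)) :=
  of_iff (.r5 i φ ψ) (fun _ => sat_ann_know) (hφ.intr.imp (h.know i))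

theorem ann_intr (hφ : Agree.{u, v, w} φ) (h : Agree.{u, v, w} (ann φ ψ)) :
    Agree.{u, v, w} (ann φ (.intr ψ)) :=
  of_iff (.r4 φ ψ) (fun _ => sat_ann_intr) (hφ.intr.imp h.intr)

/-- The hypothesis on `χ` is applied to the composite announcement `¬[φ]¬int ψ`. -/
theorem ann_ann (hφ : Agree.{u, v, w} φ) (hψ : Agree.{u, v, w} (ann φ ψ))
    (hχ : ∀ α : Formula P A, Agree.{u, v, w} α → Agree.{u, v, w} (ann α χ)) :
    Agree.{u, v, w} (ann φ (.ann ψ χ)) :=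
  of_iff (.r6 φ ψ χ) (fun _ => sat_ann_ann) (hχ _ (hφ.ann_neg (hφ.ann_intr hψ)).neg)

theorem ann_boxFree (hψ : ψ.BoxFree) (hφ : Agree.{u, v, w} φ) : Agree.{u, v, w} (ann φ ψ) := by
  induction ψ generalizing φ with
  | var p => exact hφ.ann_var p
  | neg ψ ih => exact hφ.ann_neg (ih hψ hφ)
  | and ψ χ ihψ ihχ => exact (ihψ hψ.1 hφ).ann_and (ihχ hψ.2 hφ)
  | know i ψ ih => exact hφ.ann_know i (ih hψ hφ)
  | intr ψ ih => exact hφ.ann_intr (ih hψ hφ)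
  | ann ψ χ ihψ ihχ => exact hφ.ann_ann (ihψ hψ.1 hφ) fun _ => ihχ hψ.2
  | box ψ => exact hψ.elim

theorem of_boxFree (hφ : φ.BoxFree) : Agree.{u, v, w} φ := by
  induction φ with
  | var p => exact .var p
  | neg φ ih => exact (ih hφ).neg
  | and φ ψ ihφ ihψ => exact (ihφ hφ.1).and (ihψ hφ.2)
  | know i φ ih => exact (ih hφ).know i
  | intr φ ih => exact (ih hφ).intr
  | ann φ ψ ihφ _ => exact (ihφ hφ.1).ann_boxFree hφ.2
  | box φ => exact hφ.elim

theorem ann (ψ : Formula P A) (hφ : Agree.{u, v, w} φ) : Agree.{u, v, w} (ann φ ψ) := by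
  induction ψ generalizing φ with
  | var p => exact hφ.ann_var p
  | neg ψ ih => exact hφ.ann_neg (ih hφ)
  | and ψ χ ihψ ihχ => exact (ihψ hφ).ann_and (ihχ hφ)
  | know i ψ ih => exact hφ.ann_know i (ih hφ)
  | intr ψ ih => exact hφ.ann_intr (ih hφ)
  | ann ψ χ ihψ ihχ => exact hφ.ann_ann (ihψ hφ) fun _ => ihχ
  | box χ ih =>
    intro x
    rw [x.isMaxTheory_thy.ann_box_mem_iff, sat_ann_box]
    exact forall₂_congr fun η hη => hφ.ann_ann (hφ.ann_boxFree hη) (fun _ => ih) x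

end Agree

/-- The truth lemma. -/
theorem agree (φ : Formula P A) : Agree.{u, v, w} φ := by
  induction φ with
  | var p => exact .var p
  | neg φ ih => exact ih.neg
  | and φ ψ ihφ ihψ => exact ihφ.and ihψ
  | know i φ ih => exact ih.know i
  | intr φ ih => exact ih.intr
  | ann φ ψ ihφ _ => exact ihφ.ann ψ
  | box φ =>
    intro x
    rw [x.isMaxTheory_thy.box_mem_iff, sat_box]
    exact forall₂_congr fun η hη => (Agree.of_boxFree hη).ann φ x

end Canonical

end APAL

theorem mainTheorem1 {P : Type u} {A : Type v} [Countable P] [Finite A] [Nonempty A]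
    (φ : APAL.Formula P A) (hφ : APAL.Valid.{u, v, w} φ) : APAL.Provable φ := by
  by_contra hn
  obtain ⟨x, -, hx⟩ :=
    APAL.CanonicalPoint.exists_notMem_thy.{u, v, w} APAL.isTheory_provable hn
  have : Nonempty (APAL.CanonicalPoint.{u, v, w} P A) := ⟨x⟩
  refine hx ((APAL.agree φ x).2 ?_)
  have htop : APAL.restrict APAL.CanonicalPoint.nbhd ⊤ =
      (APAL.CanonicalPoint.nbhd : APAL.CanonicalPoint.{u, v, w} P A →. _) :=
    PFun.ext' (fun _ => and_iff_left trivial) fun _ _ _ => funext fun _ => inf_top_eq _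
  exact hφ APAL.canonicalModel _ ⟨⊤, htop⟩ x trivial
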